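/- For $\alpha=(a_1,\ldots,a_k)\in\mathbb F_2^k$, a family $\mathcal F$ of subsets of $[n]=\{1,\ldots,n\}$ is called $\alpha$-intersecting if for each $i\in\{1,\ldots,k\}$ and any $i$ distinct members $F_1,\ldots,F_i$ of $\mathcal F$ one has $|F_1\cap\cdots\cap F_i|\equiv a_i \pmod 2$. Let $f_\alpha(n)$ denote the maximum size of an $\alpha$-intersecting family of subsets of $[n]$. Asymptotic notation refers to $n\to\infty$ with $k$ and $\alpha$ fixed (implied constants may depend on $\alpha$), and $f=\Omega(g)$ means $g=O(f)$. For any positive integers $\ell$ and $k\ge 2$, the number of patterns $\alpha\in\mathbb F_2^k$ such that $f_\alpha(n)=\Omega\bigl(n^{1/(2^\ell-1)}\bigr)$ is at most $2^{2^{\ell+1}-1}$, and every other pattern $\alpha\in\mathbb F_2^k$ satisfies $f_\alpha(n)=O\bigl(n^{1/2^\ell}\bigr)$. In particular, for every $k\ge 2$ there are at most $2^7$ patterns $\alpha\in\mathbb F_2^k$ with $f_\alpha(n)=\Omega(\sqrt n)$ (so the absolute constant $C=2^7$ answers a question of Johnston and O'Neill). -/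

import Mathlib

open Filter Asymptotics

/-- `F`, a family of subsets of an `n`-element set, is `α`-intersecting (modulo `2`): any `ℓ`
distinct members of `F`, `1 ≤ ℓ ≤ k`, have an intersection of size congruent to `a_ℓ` modulo `2`.
Coordinates of `α` are indexed from `0`, so `α i` is `a_{i+1}`; the `i + 1` distinct members are
the elements of a subfamily `G` of size `i + 1`, and `G.inf id` is the intersection of them all. -/
def IsAlphaIntersecting {n k : ℕ} (α : Fin k → ZMod 2) (F : Finset (Finset (Fin n))) : Prop :=
  ∀ i : Fin k, ∀ G : Finset (Finset (Fin n)), G ⊆ F → G.card = (i : ℕ) + 1 →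
    ((G.inf id).card : ZMod 2) = α i

open Classical in
/-- `f_α(n)`: the maximum size of an `α`-intersecting family of subsets of an `n`-element set
(the empty family is always `α`-intersecting, so this is the maximum of a non-empty finite set). -/
noncomputable def maxAlphaIntersecting {k : ℕ} (α : Fin k → ZMod 2) (n : ℕ) : ℕ :=
  (Finset.univ.filter fun F : Finset (Finset (Fin n)) => IsAlphaIntersecting α F).sup Finset.card

/-- `f_α(n) = O(n ^ c)` as `n → ∞`. -/
def IsBigOPower {k : ℕ} (α : Fin k → ZMod 2) (c : ℝ) : Prop :=
  (fun n : ℕ => (maxAlphaIntersecting α n : ℝ)) =O[atTop] (fun n : ℕ => (n : ℝ) ^ c)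

/-- `f_α(n) = Ω(n ^ c)` as `n → ∞`, that is, `n ^ c = O(f_α(n))`. -/
def IsBigOmegaPower {k : ℕ} (α : Fin k → ZMod 2) (c : ℝ) : Prop :=
  (fun n : ℕ => (n : ℝ) ^ c) =O[atTop] (fun n : ℕ => (maxAlphaIntersecting α n : ℝ))

/-! Put `d = 2^l`. Everything rests on one dichotomy: the growth rate is at least `n^(1/(d-1))` if
`EventuallyPeriodic α d`, and at most `n^(1/d)` otherwise. If periodicity fails,
`IsAlphaIntersecting.choose_le` factors an identity matrix of order about `|F|^d` through dimension
`n + O(|F|^(d-1))`, so `|F|^d = O(n)`. If it holds, `α` is a `d`-periodic sequence plus a correction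
below `d`. Both are realised modulo 2 by `O(m^(d-1))` points (`EventuallyPeriodic.le_max`), giving
families of size `m`. A periodic pattern is determined by its first `2d - 1` entries, whence the
count. -/

/-- The pattern `α`, indexed by intersection orders: `coord α t` is `a_t` for `1 ≤ t ≤ k`. -/
def coord {k : ℕ} (α : Fin k → ZMod 2) (t : ℕ) : ZMod 2 :=
  if h : 1 ≤ t ∧ t ≤ k then α ⟨t - 1, by omega⟩ else 0

theorem coord_succ {k : ℕ} (α : Fin k → ZMod 2) (i : Fin k) : coord α ((i : ℕ) + 1) = α i := by
  have := i.2
  rw [coord, dif_pos (by omega)]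
  congr 1

theorem IsAlphaIntersecting.card_inf {n k : ℕ} {α : Fin k → ZMod 2} {F : Finset (Finset (Fin n))}
    (hF : IsAlphaIntersecting α F) {G : Finset (Finset (Fin n))} (hG : G ⊆ F) (h1 : 1 ≤ G.card)
    (hk : G.card ≤ k) : ((G.inf id).card : ZMod 2) = coord α G.card := by
  have := hF ⟨G.card - 1, by omega⟩ G hG (by simp; omega)
  rw [this, coord, dif_pos ⟨h1, hk⟩]

/-! ### Rank bound for non-periodic patterns -/

theorem newton_expansion (g : ℕ → ZMod 2) {i d : ℕ} (h : i ≤ d) :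
    g i = ∑ e ∈ Finset.range (d + 1), (i.choose e : ZMod 2) * (fwdDiff 1)^[e] g 0 := by
  have := shift_eq_sum_fwdDiff_iter 1 g i 0
  simp only [zero_add, smul_eq_mul, mul_one, nsmul_eq_mul] at this
  rw [this]
  refine Finset.sum_subset (by intro x; simp; omega) fun x _ hx => ?_
  rw [Nat.choose_eq_zero_of_lt (by simpa using hx)]
  simp

/-- The interior binomial coefficients of `2^l` are even; this is where powers of two enter. -/
theorem fwdDiff_iter_two_pow (g : ℕ → ZMod 2) (l y : ℕ) :
    (fwdDiff 1)^[2 ^ l] g y = g (y + 2 ^ l) - g y := by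
  have := shift_eq_sum_fwdDiff_iter 1 g (2 ^ l) y
  rw [Finset.sum_range_succ, Finset.sum_eq_single_of_mem 0 (by simp)] at this
  · simp at this
    rw [this]; ring
  · intro b hb hb0
    have h2 : 2 ∣ (2 ^ l).choose b :=
      Nat.Prime.dvd_choose_pow Nat.prime_two hb0 (Finset.mem_range.1 hb).ne
    rw [nsmul_eq_mul, (ZMod.natCast_eq_zero_iff _ _).2 h2, zero_mul]

theorem card_le_of_matrix_mul_eq_one {ι κ : Type*} [Fintype ι] [Fintype κ] [DecidableEq ι]
    {A : Matrix ι κ (ZMod 2)} {B : Matrix κ ι (ZMod 2)} (h : A * B = 1) :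
    Fintype.card ι ≤ Fintype.card κ := by
  rw [← Matrix.rank_one (R := ZMod 2) (n := ι), ← h]
  exact (Matrix.rank_mul_le_left _ _).trans (Matrix.rank_le_card_width _)

/-- If `a_j ≠ a_{j+2^l}` for some `j ≥ 2^l`, the intersection numbers of an `α`-intersecting family
express an identity matrix of order `(m choose 2^l)` through few rank-one matrices. -/
theorem IsAlphaIntersecting.choose_le {n k l j : ℕ} {α : Fin k → ZMod 2}
    {F : Finset (Finset (Fin n))} (hF : IsAlphaIntersecting α F) (hj : 2 ^ l ≤ j)
    (hk : j + 2 ^ l ≤ k) (hne : coord α (j + 2 ^ l) ≠ coord α j) (hc : j - 2 ^ l ≤ F.card) :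
    (F.card - (j - 2 ^ l)).choose (2 ^ l) ≤
      n + ∑ e ∈ Finset.range (2 ^ l), (F.card - (j - 2 ^ l)).choose e := by
  obtain ⟨R, hRF, hR⟩ := Finset.exists_subset_card_eq hc
  obtain ⟨d, hd⟩ : ∃ d, d = 2 ^ l := ⟨_, rfl⟩
  have hd1 : 1 ≤ d := hd ▸ Nat.one_le_two_pow
  set E := F \ R with hE
  have hEc : E.card = F.card - (j - 2 ^ l) := by rw [Finset.card_sdiff_of_subset hRF, hR]
  rw [← hEc]
  -- For `d`-subsets `S`, `S'` of `E` meeting in `i` elements, `R ∪ S ∪ S'` has `j + d - i` members.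
  -- The Newton expansion of `g` has top term `choose i d`, which is 1 exactly when `S = S'`.
  let g : ℕ → ZMod 2 := fun i => coord α (j + 2 ^ l - i)
  let c : ℕ → ZMod 2 := fun e => (fwdDiff 1)^[e] g 0
  have hcd : c d = 1 := by
    have h1 : c d = coord α j - coord α (j + 2 ^ l) := by
      simp only [c, hd, fwdDiff_iter_two_pow, g, zero_add, Nat.add_sub_cancel, Nat.sub_zero]
    have h2 : ∀ x y : ZMod 2, x ≠ y → y - x = 1 := by decide
    rw [h1, h2 _ _ hne]
  rw [← hd]
  -- The `Fin n` block produces `g`; the block over sets of size `e < d` produces the lower Newton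
  -- terms, which cancel in characteristic 2.
  let A : Matrix {S // S ∈ E.powersetCard d} (Fin n ⊕ Σ e : Fin d, {T // T ∈ E.powersetCard e})
    (ZMod 2) := fun S => Sum.elim (fun x => if x ∈ (R ∪ S.1).inf id then 1 else 0)
      (fun T => if T.2.1 ⊆ S.1 then c T.1 else 0)
  let B : Matrix (Fin n ⊕ Σ e : Fin d, {T // T ∈ E.powersetCard e}) {S // S ∈ E.powersetCard d}
    (ZMod 2) := fun z S => Sum.elim (fun x => if x ∈ (R ∪ S.1).inf id then 1 else 0)
      (fun T => if T.2.1 ⊆ S.1 then 1 else 0) z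
  have hAB : A * B = 1 := by
    ext ⟨S, hS⟩ ⟨S', hS'⟩
    rw [Finset.mem_powersetCard] at hS hS'
    have hi : (S ∩ S').card ≤ d := hS.2 ▸ Finset.card_le_card Finset.inter_subset_left
    have hU : (R ∪ (S ∪ S')).card = j + 2 ^ l - (S ∩ S').card := by
      have hdis : Disjoint R (S ∪ S') :=
        Finset.disjoint_sdiff.mono_right (Finset.union_subset hS.1 hS'.1)
      rw [Finset.card_union_of_disjoint hdis, hR]
      have := Finset.card_union_add_card_inter S S'
      omega
    have hsub : R ∪ (S ∪ S') ⊆ F := Finset.union_subset hRF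
      ((Finset.union_subset hS.1 hS'.1).trans Finset.sdiff_subset)
    have h1 : ∑ x : Fin n, A ⟨S, by simpa using hS⟩ (Sum.inl x) *
        B (Sum.inl x) ⟨S', by simpa using hS'⟩
        = g (S ∩ S').card := by
      have : ∀ x : Fin n, A ⟨S, by simpa using hS⟩ (Sum.inl x) *
          B (Sum.inl x) ⟨S', by simpa using hS'⟩
          = if x ∈ (R ∪ (S ∪ S')).inf id then 1 else 0 := by
        intro x
        simp only [A, B, Sum.elim_inl, Finset.mem_inf, mul_ite, mul_one, mul_zero]
        rw [← ite_and]
        refine if_congr ?_ rfl rfl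
        simp only [Finset.mem_union]
        grind
      simp only [this, Finset.sum_boole, g]
      rw [← hU, ← hF.card_inf hsub (by omega) (by omega)]
      simp
    have h2 : ∀ e : Fin d, ∑ T : {T // T ∈ E.powersetCard e},
        A ⟨S, by simpa using hS⟩ (Sum.inr ⟨e, T⟩) * B (Sum.inr ⟨e, T⟩) ⟨S', by simpa using hS'⟩
        = ((S ∩ S').card.choose e : ZMod 2) * c e := by
      intro e
      have : ∀ T : {T // T ∈ E.powersetCard e}, A ⟨S, by simpa using hS⟩ (Sum.inr ⟨e, T⟩) *
          B (Sum.inr ⟨e, T⟩) ⟨S', by simpa using hS'⟩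
          = if T.1 ⊆ S ∩ S' then c e else 0 := by
        intro T
        simp only [A, B, Sum.elim_inr, mul_ite, mul_one, mul_zero]
        rw [← ite_and]
        refine if_congr ?_ rfl rfl
        rw [Finset.subset_inter_iff, and_comm]
      simp only [this]
      rw [Finset.sum_coe_sort (E.powersetCard e) (fun T => if T ⊆ S ∩ S' then c e else 0),
        ← Finset.sum_filter, Finset.sum_const, nsmul_eq_mul, ← Finset.card_powersetCard]
      congr 3
      ext T
      simp only [Finset.mem_filter, Finset.mem_powersetCard]
      exact ⟨fun h => ⟨h.2, h.1.2⟩,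
        fun h => ⟨⟨h.1.trans (Finset.inter_subset_left.trans hS.1), h.2⟩, h.1⟩⟩
    rw [Matrix.mul_apply, Fintype.sum_sum_type, h1, Fintype.sum_sigma, Finset.sum_congr rfl
      (fun e _ => h2 e), newton_expansion g hi, Finset.sum_range_succ,
      Fin.sum_univ_eq_sum_range (fun e => ((S ∩ S').card.choose e : ZMod 2) * c e) d]
    change _ + _ * c d + _ = _
    rw [hcd, add_right_comm, CharTwo.add_self_eq_zero, zero_add, mul_one, Matrix.one_apply]
    by_cases hSS : S = S'
    · subst hSS
      simp [hS.2]
    · rw [if_neg (by simpa using hSS), Nat.choose_eq_zero_of_lt, Nat.cast_zero]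
      refine lt_of_le_of_ne hi fun h => hSS ?_
      have e1 := Finset.eq_of_subset_of_card_le (Finset.inter_subset_left (s₁ := S) (s₂ := S'))
        (by omega)
      have e2 := Finset.eq_of_subset_of_card_le (Finset.inter_subset_right (s₁ := S) (s₂ := S'))
        (by omega)
      rw [← e1, e2]
  have := card_le_of_matrix_mul_eq_one hAB
  simpa only [Fintype.card_sum, Fintype.card_sigma, Fintype.card_coe, Finset.card_powersetCard,
    Fintype.card_fin, Fin.sum_univ_eq_sum_range (fun e => E.card.choose e) d] using this

theorem exists_pow_le_mul_of_choose_le {d : ℕ} (hd : 1 ≤ d) : ∃ K : ℕ, ∀ x n : ℕ, 1 ≤ n →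
    x.choose d ≤ n + ∑ e ∈ Finset.range d, x.choose e → x ^ d ≤ K * n := by
  set A := 2 ^ d * d.factorial with hA
  have hApos : 1 ≤ A := Nat.mul_pos (by positivity) d.factorial_pos
  refine ⟨(2 * A * d) ^ d + 2 * A, fun x n hn h => ?_⟩
  -- Beyond this threshold the lower binomials total at most `x^d / (2A)`, half of the main term,
  -- and are absorbed.
  rcases le_or_gt x (2 * A * d) with hx | hx
  · calc x ^ d ≤ (2 * A * d) ^ d := Nat.pow_le_pow_left hx d
      _ ≤ (2 * A * d) ^ d * n := Nat.le_mul_of_pos_right _ hn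
      _ ≤ _ := Nat.mul_le_mul_right _ (by omega)
  have h1x : 1 ≤ x := by omega
  have hdx : 2 * d ≤ x := by nlinarith
  have h1 : x ^ d ≤ A * x.choose d := by
    have h2 : (x + 1 - d) ^ d ≤ d.factorial * x.choose d := by
      rw [← Nat.descFactorial_eq_factorial_mul_choose]
      exact Nat.pow_sub_le_descFactorial x d
    calc x ^ d ≤ (2 * (x + 1 - d)) ^ d := Nat.pow_le_pow_left (by omega) d
      _ = 2 ^ d * (x + 1 - d) ^ d := mul_pow _ _ _
      _ ≤ 2 ^ d * (d.factorial * x.choose d) := Nat.mul_le_mul_left _ h2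
      _ = _ := by rw [hA, mul_assoc]
  have h2 : ∑ e ∈ Finset.range d, x.choose e ≤ d * x ^ (d - 1) := by
    refine (Finset.sum_le_card_nsmul _ _ (x ^ (d - 1)) fun e he => ?_).trans (by simp)
    have := Finset.mem_range.1 he
    exact (Nat.choose_le_pow x e).trans (Nat.pow_le_pow_right h1x (by omega))
  have h3 : 2 * A * d * x ^ (d - 1) ≤ x ^ d := by
    conv_rhs => rw [← Nat.sub_add_cancel hd, pow_succ, mul_comm]
    exact Nat.mul_le_mul_right _ hx.le
  have h4 : x ^ d ≤ 2 * A * n := by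
    have : x ^ d ≤ A * (n + d * x ^ (d - 1)) := h1.trans (Nat.mul_le_mul_left _ (by omega))
    nlinarith
  exact h4.trans (Nat.mul_le_mul_right _ (by omega))

theorem exists_card_eq_maxAlphaIntersecting {k : ℕ} (α : Fin k → ZMod 2) (n : ℕ) :
    ∃ F : Finset (Finset (Fin n)), IsAlphaIntersecting α F ∧
      F.card = maxAlphaIntersecting α n := by
  classical
  have hne : (Finset.univ.filter
      fun F : Finset (Finset (Fin n)) => IsAlphaIntersecting α F).Nonempty := by
    refine ⟨∅, Finset.mem_filter.2 ⟨Finset.mem_univ _, fun i G hG hc => ?_⟩⟩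
    rw [Finset.subset_empty.1 hG] at hc
    simp at hc
  obtain ⟨F, hF, hc⟩ := Finset.exists_mem_eq_sup _ hne Finset.card
  refine ⟨F, (Finset.mem_filter.1 hF).2, ?_⟩
  rw [maxAlphaIntersecting]
  convert hc.symm

theorem IsAlphaIntersecting.card_le_max {n k : ℕ} {α : Fin k → ZMod 2}
    {F : Finset (Finset (Fin n))} (hF : IsAlphaIntersecting α F) :
    F.card ≤ maxAlphaIntersecting α n := by
  classical
  rw [maxAlphaIntersecting]
  exact Finset.le_sup (f := Finset.card) (Finset.mem_filter.2 ⟨Finset.mem_univ _, hF⟩)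

/-- The pattern `α` is `d`-periodic from its `d`-th entry on. -/
def EventuallyPeriodic {k : ℕ} (α : Fin k → ZMod 2) (d : ℕ) : Prop :=
  ∀ j, d ≤ j → j + d ≤ k → coord α (j + d) = coord α j

theorem isBigOPower_of_not_eventuallyPeriodic {k l : ℕ} {α : Fin k → ZMod 2}
    (h : ¬ EventuallyPeriodic α (2 ^ l)) : IsBigOPower α (1 / (2 : ℝ) ^ l) := by
  simp only [EventuallyPeriodic, not_forall] at h
  obtain ⟨j, hj, hk, hne⟩ := h
  obtain ⟨K, hK⟩ := exists_pow_le_mul_of_choose_le (Nat.one_le_two_pow (n := l))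
  have hc : (0 : ℝ) ≤ 1 / 2 ^ l := by positivity
  -- The summand `k` pays for the `j - 2^l` members set aside in `R`.
  refine IsBigO.of_bound ((K : ℝ) ^ (1 / (2 : ℝ) ^ l) + k) ?_
  filter_upwards [eventually_ge_atTop 1] with n hn
  have hn' : (1 : ℝ) ≤ n := by exact_mod_cast hn
  have hone : (1 : ℝ) ≤ (n : ℝ) ^ (1 / (2 : ℝ) ^ l) := Real.one_le_rpow hn' hc
  rw [Real.norm_of_nonneg (by positivity), Real.norm_of_nonneg (by positivity)]
  obtain ⟨F, hF, hFc⟩ := exists_card_eq_maxAlphaIntersecting α n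
  rw [← hFc, add_mul]
  set x := F.card - (j - 2 ^ l) with hx
  have hFx : F.card ≤ x + k := by
    have : j - 2 ^ l ≤ k := (Nat.sub_le _ _).trans (le_of_add_le_left hk)
    omega
  have hxle : (x : ℝ) ≤ (K : ℝ) ^ (1 / (2 : ℝ) ^ l) * (n : ℝ) ^ (1 / (2 : ℝ) ^ l) := by
    rcases le_or_gt (j - 2 ^ l) F.card with hjF | hjF
    · have := hK x n hn (hF.choose_le hj hk hne hjF)
      have hr : (x : ℝ) ^ (2 ^ l : ℕ) ≤ K * n := by exact_mod_cast this
      rw [← Real.mul_rpow (by positivity) (by positivity)]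
      refine le_trans (le_of_eq ?_) (Real.rpow_le_rpow (by positivity) hr hc)
      rw [one_div, show ((2 : ℝ) ^ l) = ((2 ^ l : ℕ) : ℝ) by push_cast; rfl,
        Real.pow_rpow_inv_natCast (by positivity) (by positivity)]
    · have : x = 0 := by omega
      rw [this, Nat.cast_zero]
      positivity
  have hkle : (k : ℝ) ≤ k * (n : ℝ) ^ (1 / (2 : ℝ) ^ l) :=
    le_mul_of_one_le_right (by positivity) hone
  have : (F.card : ℝ) ≤ x + k := by exact_mod_cast hFx
  linarith

/-! ### Construction for periodic patterns -/

/-- A multiset of subsets of `Fin m`, indexed by a type with at most `n` elements, separating the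
elements of `Fin m` and containing each `T` in `a_{|T|}` members modulo 2, yields an
`α`-intersecting family of size `m`. -/
theorem le_maxAlphaIntersecting_of_points {X : Type*} [Fintype X] {k m n : ℕ}
    {α : Fin k → ZMod 2} (s : X → Finset (Fin m)) (hX : Fintype.card X ≤ n)
    (hinj : ∀ i i', (∀ x, i ∈ s x ↔ i' ∈ s x) → i = i')
    (hs : ∀ T : Finset (Fin m), 1 ≤ T.card → T.card ≤ k →
      ((Finset.univ.filter fun x => T ⊆ s x).card : ZMod 2) = coord α T.card) :
    m ≤ maxAlphaIntersecting α n := by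
  classical
  obtain ⟨φ⟩ : Nonempty (X ↪ Fin n) := Function.Embedding.nonempty_of_card_le (by simpa using hX)
  let f : Fin m ↪ Finset (Fin n) :=
    ⟨fun i => (Finset.univ.filter fun x => i ∈ s x).map φ, fun i i' h => hinj i i' fun x => by
      have := Finset.map_injective φ h
      simpa using Finset.ext_iff.1 this x⟩
  have hf : ∀ i y, y ∈ f i ↔ ∃ x, i ∈ s x ∧ φ x = y := fun i y => by
    change y ∈ (Finset.univ.filter fun x => i ∈ s x).map φ ↔ _
    simp
  have hF : IsAlphaIntersecting α (Finset.univ.map f) := by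
    intro i G hG hc
    obtain ⟨T, -, rfl⟩ := Finset.subset_map_iff.1 hG
    rw [Finset.card_map] at hc
    have hne : T.Nonempty := Finset.card_pos.1 (by omega)
    have : (T.map f).inf id = (Finset.univ.filter fun x => T ⊆ s x).map φ := by
      ext y
      simp only [Finset.mem_inf, Finset.mem_map, forall_exists_index, and_imp,
        forall_apply_eq_imp_iff₂, id, hf, Finset.mem_filter, Finset.mem_univ, true_and]
      constructor
      · intro h
        obtain ⟨t, ht⟩ := hne
        obtain ⟨x, -, rfl⟩ := h t ht
        refine ⟨x, fun u hu => ?_, rfl⟩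
        obtain ⟨x', hx', he⟩ := h u hu
        rwa [← φ.injective he]
      · rintro ⟨x, hx, rfl⟩ u hu
        exact ⟨x, hx hu, rfl⟩
    rw [this, Finset.card_map, hs T (by omega) (by have := i.2; omega), hc, coord_succ]
  simpa using hF.card_le_max

theorem card_Icc_finset_zmod_two {V : Type*} [DecidableEq V] (S T : Finset V) :
    ((Finset.Icc S T).card : ZMod 2) = if S = T then 1 else 0 := by
  split_ifs with h
  · simp [h]
  by_cases hST : S ⊆ T
  · have : S.card < T.card := Finset.card_lt_card (hST.ssubset_of_ne h)
    rw [Finset.card_Icc_finset hST, ← Nat.sub_add_cancel (Nat.sub_pos_of_lt this), pow_succ]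
    push_cast
    rw [show (2 : ZMod 2) = 0 from rfl, mul_zero]
  · rw [Finset.Icc_eq_empty hST]
    simp

/-- Möbius inversion over upper sets modulo 2. -/
theorem exists_finset_card_filter_subset {V : Type*} [Fintype V] [DecidableEq V] {D : ℕ}
    {h : Finset V → ZMod 2} (hD : ∀ U, D < U.card → h U = 0) :
    ∃ P : Finset (Finset V), (∀ S ∈ P, S.card ≤ D) ∧
      ∀ T, ((P.filter fun S => T ⊆ S).card : ZMod 2) = h T := by
  -- The Möbius coefficients, whose signs vanish modulo 2.
  let c : Finset V → ZMod 2 := fun S => ∑ U, if S ⊆ U then h U else 0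
  refine ⟨Finset.univ.filter fun S => c S ≠ 0, fun S hS => ?_, fun T => ?_⟩
  · by_contra hlt
    refine (Finset.mem_filter.1 hS).2 (Finset.sum_eq_zero fun U _ => ?_)
    split_ifs with hSU
    · exact hD U (lt_of_lt_of_le (not_le.1 hlt) (Finset.card_le_card hSU))
    · rfl
  · have h01 : ∀ z : ZMod 2, (if z ≠ 0 then 1 else 0) = z := by decide
    rw [Finset.filter_filter, ← Finset.sum_boole]
    have h1 : ∀ S : Finset V, (if c S ≠ 0 ∧ T ⊆ S then (1 : ZMod 2) else 0) =
        ∑ U, if S ∈ Finset.Icc T U then h U else 0 := by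
      intro S
      by_cases hTS : T ⊆ S
      · simp only [hTS, and_true, h01]
        simp only [c, Finset.mem_Icc, hTS, true_and]
      · simp [Finset.mem_Icc, hTS]
    rw [Finset.sum_congr rfl fun S _ => h1 S, Finset.sum_comm]
    have h2 : ∀ U : Finset V, (∑ S, if S ∈ Finset.Icc T U then h U else 0) =
        if T = U then h U else 0 := by
      intro U
      rw [← Finset.sum_filter, Finset.filter_mem_eq_inter, Finset.univ_inter, Finset.sum_const,
        nsmul_eq_mul, card_Icc_finset_zmod_two, ite_mul, one_mul, zero_mul]
    rw [Finset.sum_congr rfl fun U _ => h2 U, Finset.sum_ite_eq, if_pos (Finset.mem_univ _)]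

theorem sum_powerset_sum_powerset {V : Type*} [DecidableEq V] (g : Finset V → ZMod 2)
    (T : Finset V) : ∑ U ∈ T.powerset, ∑ W ∈ U.powerset, g W = g T := by
  have : ∑ U ∈ T.powerset, ∑ W ∈ U.powerset, g W =
      ∑ W ∈ T.powerset, ∑ _U ∈ Finset.Icc W T, g W := by
    refine Finset.sum_comm' fun U W => ?_
    simp only [Finset.mem_powerset, Finset.mem_Icc]
    exact ⟨fun h => ⟨⟨h.2, h.1⟩, h.2.trans h.1⟩, fun h => ⟨h.1.2, h.1.1⟩⟩
  rw [this]
  simp [card_Icc_finset_zmod_two]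

/-- Sets avoiding few elements realise functions with low-degree transform: `T ∩ S` has an odd
number of subsets only when empty, so the count is the subset sum of the transform of `g`, which is
`g` again. -/
theorem exists_finset_card_filter_disjoint {V : Type*} [Fintype V] [DecidableEq V] {D : ℕ}
    {g : Finset V → ZMod 2} (hD : ∀ U : Finset V, D < U.card → ∑ W ∈ U.powerset, g W = 0) :
    ∃ Q : Finset (Finset V), (∀ S ∈ Q, S.card ≤ D) ∧
      ∀ T, ((Q.filter fun S => T ⊆ Sᶜ).card : ZMod 2) = g T := by
  obtain ⟨Q, hQ, h⟩ := exists_finset_card_filter_subset hD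
  refine ⟨Q, hQ, fun T => ?_⟩
  rw [← sum_powerset_sum_powerset g T, ← Finset.sum_congr rfl fun U _ => h U]
  have h1 : ∀ S : Finset V, (if T ⊆ Sᶜ then (1 : ZMod 2) else 0) =
      ∑ U ∈ T.powerset, if U ⊆ S then 1 else 0 := by
    intro S
    have h2 : T.powerset.filter (fun U => U ⊆ S) = Finset.Icc ∅ (T ∩ S) := by
      ext U
      simp [Finset.subset_inter_iff]
    rw [Finset.sum_boole, h2, card_Icc_finset_zmod_two]
    refine if_congr ?_ rfl rfl
    rw [Finset.subset_compl_iff_disjoint_right, Finset.disjoint_iff_inter_eq_empty, eq_comm]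
  rw [← Finset.sum_boole, Finset.sum_congr rfl fun S _ => h1 S, Finset.sum_comm]
  simp

theorem sum_powerset_card_eq_fwdDiff {V : Type*} (p : ℕ → ZMod 2) (U : Finset V) :
    ∑ W ∈ U.powerset, p W.card = (fwdDiff 1)^[U.card] p 0 := by
  rw [Finset.sum_powerset_apply_card, fwdDiff_iter_eq_sum_shift]
  refine Finset.sum_congr rfl fun i _ => ?_
  simp [show (-1 : ZMod 2) = 1 from rfl]

theorem sum_powerset_card_eq_zero {V : Type*} {p : ℕ → ZMod 2} {l : ℕ}
    (hp : ∀ t, p (t + 2 ^ l) = p t) {U : Finset V} (hU : 2 ^ l ≤ U.card) :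
    ∑ W ∈ U.powerset, p W.card = 0 := by
  have h0 : (fwdDiff 1)^[2 ^ l] p = 0 := by
    ext y
    rw [fwdDiff_iter_two_pow, hp, sub_self, Pi.zero_apply]
  rw [sum_powerset_card_eq_fwdDiff, ← Nat.sub_add_cancel hU, Function.iterate_add_apply, h0,
    fwdDiff_iter_eq_sum_shift]
  simp

theorem card_le_of_forall_card_le {m D : ℕ} (hm : 1 ≤ m) {P : Finset (Finset (Fin m))}
    (hP : ∀ S ∈ P, S.card ≤ D) : P.card ≤ (D + 1) * m ^ D := by
  have hsub : P ⊆ (Finset.range (D + 1)).biUnion fun e => Finset.univ.powersetCard e := by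
    intro S hS
    simpa [Nat.lt_succ_iff] using hP S hS
  refine (Finset.card_le_card hsub).trans ((Finset.card_biUnion_le_card_mul _ _ (m ^ D)
    fun e he => ?_).trans (by simp))
  rw [Finset.card_powersetCard, Finset.card_univ, Fintype.card_fin]
  exact (Nat.choose_le_pow m e).trans
    (Nat.pow_le_pow_right hm (Nat.lt_succ_iff.1 (Finset.mem_range.1 he)))

theorem EventuallyPeriodic.exists_periodic {k d : ℕ} {α : Fin k → ZMod 2}
    (h : EventuallyPeriodic α d) (hd : 1 ≤ d) :
    ∃ p : ℕ → ZMod 2, (∀ t, p (t + d) = p t) ∧ ∀ t, d ≤ t → t ≤ k → coord α t = p t := by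
  -- For `d ≤ t ≤ k` the index `d + t % d` is at most `t`, so the default value of `coord` beyond
  -- `k` does no harm.
  refine ⟨fun t => coord α (d + t % d), fun t => by simp, fun t => ?_⟩
  induction t using Nat.strong_induction_on with
  | _ t ih =>
    intro h1 h2
    rcases lt_or_ge t (2 * d) with hlt | hge
    · have : t % d = t - d := by
        rw [Nat.mod_eq_sub_mod h1, Nat.mod_eq_of_lt (by omega)]
      simp only [this]
      congr 1
      omega
    · have h3 := ih (t - d) (by omega) (by omega) (by omega)
      have h4 := h (t - d) (by omega) (by omega)
      rw [Nat.sub_add_cancel h1] at h4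
      rw [h4, h3]
      simp only [Nat.mod_eq_sub_mod h1]

theorem EventuallyPeriodic.le_max {k l : ℕ} {α : Fin k → ZMod 2}
    (h : EventuallyPeriodic α (2 ^ l)) (hl : 1 ≤ l) {m n : ℕ} (hm : 1 ≤ m)
    (hn : (2 * 2 ^ l + 2) * m ^ (2 ^ l - 1) ≤ n) : m ≤ maxAlphaIntersecting α n := by
  have hd : 2 ≤ 2 ^ l := by simpa using Nat.pow_le_pow_right (n := 2) (by norm_num) hl
  obtain ⟨p, hp, hpα⟩ := h.exists_periodic (by omega)
  let q : ℕ → ZMod 2 := fun t => if t < 2 ^ l then coord α t - p t else 0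
  obtain ⟨P, hP, hPq⟩ := exists_finset_card_filter_subset (V := Fin m) (D := 2 ^ l - 1)
    (h := fun U => q U.card) (fun U hU => if_neg (by omega))
  obtain ⟨Q, hQ, hQp⟩ := exists_finset_card_filter_disjoint (V := Fin m) (D := 2 ^ l - 1)
    (g := fun U => p U.card) (fun U hU => sum_powerset_card_eq_zero hp (by omega))
  -- `P` realises the correction `q` and `Q` the periodic part `p`. Each singleton occurs twice,
  -- separating elements without changing parities.
  let s : P ⊕ Q ⊕ (Fin m × Bool) → Finset (Fin m) :=
    Sum.elim (fun S => S.1) (Sum.elim (fun S => S.1ᶜ) fun x => {x.1})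
  refine le_maxAlphaIntersecting_of_points s ?_ ?_ ?_
  · have h1 := card_le_of_forall_card_le hm hP
    have h2 := card_le_of_forall_card_le hm hQ
    have h3 : m ≤ m ^ (2 ^ l - 1) := Nat.le_self_pow (by omega) m
    rw [Nat.sub_add_cancel (by omega)] at h1 h2
    simp only [Fintype.card_sum, Fintype.card_coe, Fintype.card_prod, Fintype.card_fin,
      Fintype.card_bool]
    linarith
  · intro i i' hi
    simpa [s, eq_comm] using hi (Sum.inr (Sum.inr (i, true)))
  · intro T h1 hk
    rw [← Finset.sum_boole, Fintype.sum_sum_type, Fintype.sum_sum_type, Fintype.sum_prod_type]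
    change (∑ S : P, if T ⊆ S.1 then (1 : ZMod 2) else 0) +
      ((∑ S : Q, if T ⊆ S.1ᶜ then (1 : ZMod 2) else 0) +
        ∑ i : Fin m, ∑ _b : Bool, if T ⊆ {i} then (1 : ZMod 2) else 0) = _
    rw [Finset.sum_coe_sort P (fun S => if T ⊆ S then (1 : ZMod 2) else 0),
      Finset.sum_coe_sort Q (fun S => if T ⊆ Sᶜ then (1 : ZMod 2) else 0),
      Finset.sum_boole, Finset.sum_boole, hPq, hQp, Finset.sum_eq_zero (s := Finset.univ), add_zero]
    · by_cases ht : T.card < 2 ^ l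
      · simp [q, ht]
      · simp [q, ht, hpα _ (not_lt.1 ht) hk]
    · intro x _
      rw [Fintype.sum_bool, CharTwo.add_self_eq_zero]

theorem EventuallyPeriodic.isBigOmegaPower {k l : ℕ} {α : Fin k → ZMod 2}
    (h : EventuallyPeriodic α (2 ^ l)) (hl : 1 ≤ l) :
    IsBigOmegaPower α (1 / ((2 : ℝ) ^ l - 1)) := by
  have hd : 2 ≤ 2 ^ l := by simpa using Nat.pow_le_pow_right (n := 2) (by norm_num) hl
  set D := 2 ^ l - 1 with hD
  have hD0 : D ≠ 0 := by omega
  have hDr : (2 : ℝ) ^ l - 1 = (D : ℝ) := by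
    rw [hD, Nat.cast_sub (by omega)]
    push_cast
    rfl
  set C := 2 * 2 ^ l + 2 with hC
  rw [IsBigOmegaPower, hDr, one_div]
  refine IsBigO.of_bound ((C : ℝ) ^ ((D : ℝ)⁻¹) * 2) ?_
  filter_upwards [eventually_ge_atTop C] with n hn
  rw [Real.norm_of_nonneg (by positivity), Real.norm_of_nonneg (by positivity)]
  set x := maxAlphaIntersecting α n with hx
  have h1 : 1 ≤ x := h.le_max hl le_rfl (by simpa using hn)
  have h2 : n ≤ C * (x + 1) ^ D := by
    by_contra hlt
    have := h.le_max hl (m := x + 1) (n := n) (by omega) (not_le.1 hlt).le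
    omega
  have h3 : (n : ℝ) ≤ C * ((x : ℝ) + 1) ^ D := by exact_mod_cast h2
  have h4 : (1 : ℝ) ≤ x := by exact_mod_cast h1
  calc (n : ℝ) ^ ((D : ℝ)⁻¹) ≤ (C * ((x : ℝ) + 1) ^ D) ^ ((D : ℝ)⁻¹) :=
        Real.rpow_le_rpow (by positivity) h3 (by positivity)
    _ = (C : ℝ) ^ ((D : ℝ)⁻¹) * (x + 1) := by
        rw [Real.mul_rpow (by positivity) (by positivity),
          Real.pow_rpow_inv_natCast (by positivity) hD0]
    _ ≤ (C : ℝ) ^ ((D : ℝ)⁻¹) * (2 * x) := by gcongr; linarith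
    _ = _ := by ring

/-! ### Comparing growth rates and counting patterns -/

theorem IsBigOmegaPower.not_isBigOPower {k : ℕ} {α : Fin k → ZMod 2} {b c : ℝ} (hbc : b < c)
    (h : IsBigOmegaPower α c) : ¬ IsBigOPower α b := by
  intro h'
  have h1 : (fun n : ℕ => (n : ℝ) ^ c) =O[atTop] fun n : ℕ => (n : ℝ) ^ b := h.trans h'
  have hpos : ∀ᶠ n : ℕ in atTop, (0 : ℝ) < n := by
    filter_upwards [eventually_ge_atTop 1] with n hn
    exact_mod_cast hn
  have h2 : (fun n : ℕ => (n : ℝ) ^ b) =o[atTop] fun n : ℕ => (n : ℝ) ^ c := by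
    refine (isLittleO_iff_tendsto' (hpos.mono fun n hn h0 => ?_)).2 ?_
    · exact absurd h0 (Real.rpow_pos_of_pos hn c).ne'
    · refine ((tendsto_rpow_neg_atTop (sub_pos.2 hbc)).comp tendsto_natCast_atTop_atTop).congr'
        (hpos.mono fun n hn => ?_)
      rw [Function.comp_apply, neg_sub, Real.rpow_sub hn]
  exact h2.not_isBigO (hpos.mono fun n hn => (Real.rpow_pos_of_pos hn b).ne').frequently h1

theorem IsBigOmegaPower.mono {k : ℕ} {α : Fin k → ZMod 2} {b c : ℝ} (hbc : b ≤ c)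
    (h : IsBigOmegaPower α c) : IsBigOmegaPower α b := by
  refine IsBigO.trans (IsBigO.of_bound 1 ?_) h
  filter_upwards [eventually_ge_atTop 1] with n hn
  rw [Real.norm_of_nonneg (by positivity), Real.norm_of_nonneg (by positivity), one_mul]
  exact Real.rpow_le_rpow_of_exponent_le (by exact_mod_cast hn) hbc

theorem EventuallyPeriodic.ext {k d : ℕ} {α β : Fin k → ZMod 2} (hd : 1 ≤ d)
    (hα : EventuallyPeriodic α d) (hβ : EventuallyPeriodic β d)
    (h : ∀ t, 1 ≤ t → t < 2 * d → coord α t = coord β t) : α = β := by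
  have key : ∀ t, 1 ≤ t → t ≤ k → coord α t = coord β t := by
    intro t
    induction t using Nat.strong_induction_on with
    | _ t ih =>
      intro h1 h2
      rcases lt_or_ge t (2 * d) with hlt | hge
      · exact h t h1 hlt
      · have h3 := hα (t - d) (by omega) (by omega)
        have h4 := hβ (t - d) (by omega) (by omega)
        rw [Nat.sub_add_cancel (by omega)] at h3 h4
        rw [h3, h4, ih (t - d) (by omega) (by omega) (by omega)]
  ext i
  rw [← coord_succ α, ← coord_succ β, key _ (by omega) (by have := i.2; omega)]

theorem ncard_eventuallyPeriodic_le (k : ℕ) {d : ℕ} (hd : 1 ≤ d) :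
    {α : Fin k → ZMod 2 | EventuallyPeriodic α d}.ncard ≤ 2 ^ (2 * d - 1) := by
  let f : (Fin k → ZMod 2) → (Fin (2 * d - 1) → ZMod 2) := fun α i => coord α (i + 1)
  have hinj : Set.InjOn f {α | EventuallyPeriodic α d} := by
    intro α hα β hβ hf
    refine EventuallyPeriodic.ext hd hα hβ fun t h1 h2 => ?_
    have := congrFun hf ⟨t - 1, by omega⟩
    simpa only [f, Nat.sub_add_cancel h1] using this
  have := Set.ncard_le_ncard_of_injOn (t := Set.univ) f (fun _ _ => Set.mem_univ _) hinj
  simpa [Set.ncard_univ, Nat.card_eq_fintype_card] using this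

theorem isBigOmegaPower_iff_eventuallyPeriodic {k l : ℕ} (hl : 1 ≤ l) {α : Fin k → ZMod 2} :
    IsBigOmegaPower α (1 / ((2 : ℝ) ^ l - 1)) ↔ EventuallyPeriodic α (2 ^ l) := by
  refine ⟨fun h => ?_, fun h => h.isBigOmegaPower hl⟩
  by_contra hp
  have h2 : (1 : ℝ) < 2 ^ l := one_lt_pow₀ (by norm_num) (by omega)
  exact h.not_isBigOPower (one_div_lt_one_div_of_lt (by linarith) (by linarith))
    (isBigOPower_of_not_eventuallyPeriodic hp)

theorem ncard_isBigOmegaPower_le {l : ℕ} (hl : 1 ≤ l) (k : ℕ) :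
    {α : Fin k → ZMod 2 | IsBigOmegaPower α (1 / ((2 : ℝ) ^ l - 1))}.ncard
      ≤ 2 ^ (2 ^ (l + 1) - 1) := by
  simp only [isBigOmegaPower_iff_eventuallyPeriodic hl, pow_succ' 2 l]
  exact ncard_eventuallyPeriodic_le k Nat.one_le_two_pow

theorem theorem2 :
    (∀ ℓ k : ℕ, 1 ≤ ℓ → 2 ≤ k →
      {α : Fin k → ZMod 2 | IsBigOmegaPower α (1 / ((2 : ℝ) ^ ℓ - 1))}.ncard
          ≤ 2 ^ (2 ^ (ℓ + 1) - 1) ∧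
      ∀ α : Fin k → ZMod 2, ¬ IsBigOmegaPower α (1 / ((2 : ℝ) ^ ℓ - 1)) →
        IsBigOPower α (1 / (2 : ℝ) ^ ℓ)) ∧
    (∀ k : ℕ, 2 ≤ k →
      {α : Fin k → ZMod 2 | IsBigOmegaPower α (1 / 2)}.ncard ≤ 2 ^ 7) := by
  refine ⟨fun ℓ k hℓ _ => ⟨ncard_isBigOmegaPower_le hℓ k, fun α h =>
    isBigOPower_of_not_eventuallyPeriodic
      (mt (isBigOmegaPower_iff_eventuallyPeriodic hℓ).2 h)⟩, fun k _ => ?_⟩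
  -- Since `1/2 ≥ 1/3`, the case `l = 2` applies, with bound `2^(2^3 - 1)`.
  refine (Set.ncard_le_ncard (fun α h => ?_) (Set.toFinite _)).trans
    (ncard_isBigOmegaPower_le (l := 2) one_le_two k)
  exact IsBigOmegaPower.mono (by norm_num) h
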